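/- A random tree evolves in continuous time as follows. At time $0$ it consists of one living node, the root. Every living node has an exponentially distributed lifetime $\tau$, $\mathcal P\{\tau\le t\}=1-e^{-Qt}$ with $Q>0$; at the end of its life it dies and produces at that moment $\nu\in\{0,1,2,\dots\}$ new living nodes, where $\mathcal P\{\nu=j\}=f_j$, $\sum_{j\ge0}f_j=1$ and $f_1\neq1$. All lifetimes and offspring numbers are independent. Let $\mu(t)$ be the total number of nodes (living and dead) at time $t$, let $q(z)=\sum_{j\ge0}f_jz^j$, and let $q_1=\sum_{j\ge0}j f_j\in[0,\infty]$. Then for every $n\ge0$ the limit $p_n=\lim_{t\to\infty}\mathcal P\{\mu(t)=n\}$ exists, with $p_0=0$, $p_n\ge0$ and $\sum_n p_n<\infty$, and the generating function $g(z)=\sum_{n\ge1}p_nz^n$ has the following properties. 1. For all real $z$ with $|z|\le1$, $g(z)=z\,q[g(z)]$, and $g(0)=0$. Moreover, $g$ is on $[0,1)$ the only continuous real solution $h$ of $h(z)=z\,q[h(z)]$ with $h(0)=0$ (where the series $q[h(z)]$ is required to converge). 2. $\lim_{z\uparrow1}g(z)=\sum_{n\ge1}p_n$. If $q_1\le1$,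 then $\lim_{z\uparrow1}g(z)=1$; if $q_1>1$, then $\lim_{z\uparrow1}g(z)<1$. 3. The number $w_\infty=1-\sum_{n\ge1}p_n$ is the probability that $\mu(t)\to\infty$ as $t\to\infty$, and $w_\infty=0$ if and only if $q_1\le1$. -/

import Mathlib

open MeasureTheory ProbabilityTheory Filter Topology Set

namespace EvolvingTree

/-- A (potential) node is addressed by a finite word: `[]` is the root and `i :: u` is the `i`-th
child (`i = 0, 1, …`) of the node `u`. Given the numbers `ν u` of children that the nodes `u`
produce, this says that the node is ever born. -/
def InTree (ν : List ℕ → ℕ) : List ℕ → Prop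
  | [] => True
  | i :: u => InTree ν u ∧ i < ν u

/-- The time at which a node is born, given the lifetimes `τ u` of the nodes `u`: the root is
alive from time `0`, and a child is born at the moment when its parent dies. -/
def birthTime (τ : List ℕ → ℝ) : List ℕ → ℝ
  | [] => 0
  | _ :: u => birthTime τ u + τ u

/-- The tree size `μ(t)`: the total number of nodes, living or dead, that are present at time `t`,
i.e. that have been born up to time `t`. -/
noncomputable def treeSize (ν : List ℕ → ℕ) (τ : List ℕ → ℝ) (t : ℝ) : ℕ∞ :=
  {u : List ℕ | InTree ν u ∧ birthTime τ u ≤ t}.encard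

/-- The generating function `z ↦ ∑ aₙ zⁿ` of a real sequence. -/
noncomputable def genFun (a : ℕ → ℝ) (z : ℝ) : ℝ := ∑' n, a n * z ^ n

/-- The generating function `q(z) = ∑ fₙ zⁿ` of the offspring law `f`. -/
noncomputable def offspringGF (f : PMF ℕ) (z : ℝ) : ℝ := genFun (fun n => (f n).toReal) z

/-- The mean `q₁ = ∑ n fₙ ∈ [0, ∞]` of the offspring law `f`. -/
noncomputable def offspringMean (f : PMF ℕ) : ENNReal := ∑' n : ℕ, (n : ENNReal) * f n

end EvolvingTree

/-!
The lifetimes play no role in the limit. Every node has a finite birth time, so for each realization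
the tree size increases to the total progeny `N ∈ ℕ∞` of the Galton-Watson tree
(`tendsto_treeSize`). By dominated convergence `P(μ(t) = n) → pₙ = P(N = n)`, and `μ(t) → ∞` holds
exactly on `{N = ∞}`, which has probability `1 - ∑ pₙ`.

For `|z| ≤ 1` the generating function `g(z) = ∑ pₙ zⁿ` is the expectation of `z ^ N` with the
convention `z ^ ∞ = 0`. The total progeny is `N = 1 + N₀ + ⋯ + N_{j-1}` where `j` is the number of
children of the root and `Nᵢ` is the total progeny of the `i`-th child (`progeny_eq`). The `Nᵢ` are
independent copies of `N`, independent of `j` (`setIntegral_prod_subtree`), so conditioning on `j`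
gives `g(z) = z q(g(z))` (`genFun_progenyProb`).

The rest is about fixed points of `w ↦ z q(w)` and rests on the inequality
`|q(w) - q(g)| ≤ |w - g| (1 - q(g)) / (1 - g)` for `|w| ≤ 1` and `0 ≤ g < 1`, where
`(1 - q(g)) / (1 - g) = ∑ₙ fₙ (1 + g + ⋯ + g ^ (n - 1))` (`hasSum_geom_sum`). If `g = z q(g)` and
`z < 1`, then `z (1 - q(g)) / (1 - g) = (z - g) / (1 - g) < 1`, so that `g` is the only fixed point in
`[-1, 1]` (`eq_of_fixedPoint`), an interval that a continuous solution starting at zero cannot leave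
(`abs_le_one_of_fixedPoint`). By Abel's theorem `g(z) → s = ∑ pₙ` as `z ↑ 1`, and `s = q(s)`. If
`s < 1`, the quotient at `s` equals one, and comparing it term by term with the mean `∑ n fₙ` gives
`q₁ > 1` (`one_lt_mean_of_fixedPoint`); the inequality is strict because `s = q(s) < 1` and `f₁ ≠ 1`
leave some `fₙ > 0` with `n ≥ 2`. If `s = 1`, the quotients at `g(z) < 1` are at most one and
`g(z) → 1`, which gives `q₁ ≤ 1` (`sum_mean_le_one`).
-/

namespace EvolvingTree

/-! ### The stationary tree -/

/-- The number of nodes that are ever born, possibly `⊤`. -/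
noncomputable def progeny (ν : List ℕ → ℕ) : ℕ∞ := {u : List ℕ | InTree ν u}.encard

/-- The tree size converges for every realization, whatever the lifetimes are: each node has a
finite birth time, so any finite set of nodes is eventually present. -/
lemma tendsto_treeSize (ν : List ℕ → ℕ) (τ : List ℕ → ℝ) :
    Tendsto (treeSize ν τ) atTop (𝓝 (progeny ν)) := by
  refine tendsto_order.2 ⟨fun a ha => ?_, fun a ha => ?_⟩
  · obtain ⟨T, hTS, hT⟩ := exists_subset_encard_eq (Order.add_one_le_of_lt ha)
    have ha' : a ≠ ⊤ := ha.ne_top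
    have hfin : T.Finite := finite_of_encard_le_coe (k := a.toNat + 1) (by
      rw [hT]; push_cast; rw [ENat.natCast_toNat ha'])
    have hev : ∀ᶠ t in atTop, ∀ u ∈ T, birthTime τ u ≤ t :=
      (hfin.eventually_all).2 fun u _ => eventually_ge_atTop _
    filter_upwards [hev] with t ht
    have hsub : T ⊆ {u | InTree ν u ∧ birthTime τ u ≤ t} := fun u hu => ⟨hTS hu, ht u hu⟩
    exact ((ENat.lt_add_one_iff ha').2 le_rfl).trans_le (hT ▸ encard_le_encard hsub)
  · exact Eventually.of_forall fun t => lt_of_le_of_lt (encard_le_encard fun u hu => hu.1) ha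

lemma eventually_treeSize_eq_iff (ν : List ℕ → ℕ) (τ : List ℕ → ℝ) (n : ℕ) :
    ∀ᶠ t in atTop, treeSize ν τ t = n ↔ progeny ν = n := by
  have h := tendsto_treeSize ν τ
  by_cases hn : progeny ν = n
  · rw [hn, ENat.nhds_natCast, tendsto_pure] at h
    filter_upwards [h] with t ht
    simp [ht, hn]
  · filter_upwards [h.eventually_ne hn] with t ht
    simp [ht, hn]

lemma tendsto_treeSize_top_iff (ν : List ℕ → ℕ) (τ : List ℕ → ℝ) :
    Tendsto (treeSize ν τ) atTop (𝓝 ⊤) ↔ progeny ν = ⊤ :=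
  ⟨fun h => tendsto_nhds_unique (tendsto_treeSize ν τ) h, fun h => h ▸ tendsto_treeSize ν τ⟩

lemma inTree_append_singleton (ν : List ℕ → ℕ) (u : List ℕ) (i : ℕ) :
    InTree ν (u ++ [i]) ↔ i < ν [] ∧ InTree (fun v => ν (v ++ [i])) u := by
  induction u with
  | nil => simp [InTree]
  | cons j u ih => simp only [List.cons_append, InTree, ih, and_assoc]

/-- The total progeny is one (for the root) plus the total progenies of the root's children. -/
lemma progeny_eq (ν : List ℕ → ℕ) :
    progeny ν = 1 + ∑ i : Fin (ν []), progeny fun u => ν (u ++ [(i : ℕ)]) := by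
  have hset : {u : List ℕ | InTree ν u} = {[]} ∪
      ⋃ i : Fin (ν []), (fun u => u ++ [(i : ℕ)]) ''
        {u | InTree (fun v => ν (v ++ [(i : ℕ)])) u} := by
    ext u
    rcases List.eq_nil_or_concat u with rfl | ⟨v, i, rfl⟩
    · simp [InTree]
    · simp only [List.concat_eq_append, mem_ofPred_eq, inTree_append_singleton, mem_union,
        mem_singleton_iff, List.append_eq_nil_iff, List.cons_ne_nil, and_false, false_or,
        mem_iUnion, mem_image, List.append_singleton_inj]
      constructor
      · rintro ⟨hi, hv⟩
        exact ⟨⟨i, hi⟩, v, hv, rfl, rfl⟩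
      · rintro ⟨k, w, hw, rfl, rfl⟩
        exact ⟨k.2, hw⟩
  have hdisj : Pairwise (Function.onFun Disjoint fun i : Fin (ν []) =>
      (fun u : List ℕ => u ++ [(i : ℕ)]) '' {u | InTree (fun v => ν (v ++ [(i : ℕ)])) u}) := by
    intro i j hij
    refine disjoint_left.2 ?_
    rintro _ ⟨u, -, rfl⟩ ⟨v, -, h⟩
    simp only [List.append_singleton_inj] at h
    exact hij (Fin.ext h.2.symm)
  rw [progeny, hset, encard_union_eq, encard_singleton, encard_iUnion_of_finite hdisj,
    finsum_eq_sum_of_fintype]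
  · congr 1
    refine Finset.sum_congr rfl fun i _ => ?_
    exact InjOn.encard_image fun u _ v _ h => (List.append_singleton_inj.1 h).1
  · simp

lemma progeny_ne_zero (ν : List ℕ → ℕ) : progeny ν ≠ 0 := by
  rw [progeny_eq]; simp

/-! ### Measurability -/

/-- The size of a random subset of a countable type is a random variable. -/
lemma measurable_encard_setOf {Ω α : Type*} [MeasurableSpace Ω] [Countable α]
    {A : α → Set Ω} (hA : ∀ a, MeasurableSet (A a)) :
    Measurable fun ω => {a | ω ∈ A a}.encard := by
  have hle (n : ℕ) : MeasurableSet {ω | (n : ℕ∞) ≤ {a | ω ∈ A a}.encard} := by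
    have : {ω | (n : ℕ∞) ≤ {a | ω ∈ A a}.encard} =
        ⋃ F : {F : Finset α // F.card = n}, ⋂ a ∈ F.1, A a := by
      ext ω
      simp only [mem_ofPred_eq, mem_iUnion, mem_iInter]
      constructor
      · intro h
        obtain ⟨T, hTS, hT⟩ := exists_subset_encard_eq h
        have hfin : T.Finite := finite_of_encard_eq_coe hT
        lift T to Finset α using hfin
        exact ⟨⟨T, by simpa using hT⟩, fun a ha => hTS ha⟩
      · rintro ⟨⟨F, rfl⟩, hF⟩
        rw [← encard_coe_eq_coe_finsetCard]
        exact encard_le_encard fun a ha => hF a ha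
    rw [this]
    exact .iUnion fun F => .biInter (Finset.countable_toSet _) fun a _ => hA a
  have heq (n : ℕ) : MeasurableSet {ω | {a | ω ∈ A a}.encard = n} := by
    have : {ω | {a | ω ∈ A a}.encard = n} = {ω | (n : ℕ∞) ≤ {a | ω ∈ A a}.encard} \
        {ω | ((n + 1 : ℕ) : ℕ∞) ≤ {a | ω ∈ A a}.encard} := by
      ext ω
      simp only [mem_ofPred_eq, Set.mem_sdiff, not_le]
      rw [Nat.cast_add, Nat.cast_one, ENat.lt_add_one_iff (ENat.natCast_ne_top n), le_antisymm_iff,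
        and_comm]
    rw [this]
    exact (hle n).diff (hle _)
  refine measurable_to_countable' fun x => ?_
  induction x with
  | coe n => exact heq n
  | top =>
    have : (fun ω => {a | ω ∈ A a}.encard) ⁻¹' {⊤} = ⋂ n : ℕ, {ω | {a | ω ∈ A a}.encard = n}ᶜ := by
      ext ω
      simp only [mem_preimage, mem_singleton_iff, mem_iInter, mem_compl_iff, mem_ofPred_eq]
      rw [ENat.eq_top_iff_forall_ne]
      exact forall_congr' fun n => ne_comm
    rw [this]
    exact .iInter fun n => (heq n).compl

lemma measurableSet_inTree (u : List ℕ) : MeasurableSet {x : List ℕ → ℕ | InTree x u} := by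
  induction u with
  | nil => simp [InTree]
  | cons i u ih => exact ih.inter (measurableSet_lt measurable_const (measurable_pi_apply u))

lemma measurable_progeny : Measurable progeny := measurable_encard_setOf measurableSet_inTree

lemma measurable_birthTime (u : List ℕ) : Measurable fun y : List ℕ → ℝ => birthTime y u := by
  induction u with
  | nil => exact measurable_const
  | cons i u ih => exact ih.add (measurable_pi_apply u)

lemma measurable_treeSize {Ω : Type*} [MeasurableSpace Ω] {ν : List ℕ → Ω → ℕ}
    {τ : List ℕ → Ω → ℝ} (hν : ∀ u, Measurable (ν u)) (hτ : ∀ u, Measurable (τ u)) (t : ℝ) :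
    Measurable fun ω => treeSize (fun u => ν u ω) (fun u => τ u ω) t :=
  measurable_encard_setOf (A := fun u => {ω | InTree (fun u => ν u ω) u ∧
      birthTime (fun u => τ u ω) u ≤ t}) fun u =>
    (measurable_pi_lambda _ hν (measurableSet_inTree u)).inter
      (measurableSet_le ((measurable_birthTime u).comp (measurable_pi_lambda _ hτ))
        measurable_const)

/-! ### Generating functions of probability laws -/

lemma abs_pow_sub_pow_le_geom_sum {w g : ℝ} (hw : |w| ≤ 1) (hg : 0 ≤ g) (n : ℕ) :
    |w ^ n - g ^ n| ≤ |w - g| * ∑ k ∈ Finset.range n, g ^ k := by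
  rw [← (Commute.all w g).geom_sum₂_mul, abs_mul, mul_comm]
  gcongr
  refine (Finset.abs_sum_le_sum_abs _ _).trans ?_
  rw [← Finset.sum_range_reflect (fun k => g ^ k)]
  refine Finset.sum_le_sum fun k _ => ?_
  rw [abs_mul, abs_pow, abs_pow, abs_of_nonneg hg, Nat.sub_right_comm]
  exact mul_le_of_le_one_left (by positivity) (pow_le_one₀ (abs_nonneg _) hw)

lemma summable_mul_pow {a : ℕ → ℝ} (ha : ∀ n, 0 ≤ a n) (hs : Summable a) {z : ℝ} (hz : |z| ≤ 1) :
    Summable fun n => a n * z ^ n := by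
  refine hs.of_norm_bounded fun n => ?_
  rw [Real.norm_eq_abs, abs_mul, abs_of_nonneg (ha n), abs_pow]
  exact mul_le_of_le_one_right (ha n) (pow_le_one₀ (abs_nonneg _) hz)

lemma abs_genFun_le {a : ℕ → ℝ} (ha : ∀ n, 0 ≤ a n) (hs : Summable a) {z : ℝ} (hz : |z| ≤ 1) :
    |genFun a z| ≤ ∑' n, a n := by
  rw [← Real.norm_eq_abs]
  refine tsum_of_norm_bounded hs.hasSum fun n => ?_
  rw [Real.norm_eq_abs, abs_mul, abs_of_nonneg (ha n), abs_pow]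
  exact mul_le_of_le_one_right (ha n) (pow_le_one₀ (abs_nonneg _) hz)

lemma genFun_nonneg {a : ℕ → ℝ} (ha : ∀ n, 0 ≤ a n) {z : ℝ} (hz : 0 ≤ z) : 0 ≤ genFun a z :=
  tsum_nonneg fun n => mul_nonneg (ha n) (pow_nonneg hz n)

lemma genFun_zero (a : ℕ → ℝ) : genFun a 0 = a 0 := by
  rw [genFun, tsum_eq_single 0 fun n hn => by simp [hn]]
  simp

lemma tendsto_genFun {a : ℕ → ℝ} (hs : Summable a) :
    Tendsto (genFun a) (𝓝[<] 1) (𝓝 (∑' n, a n)) :=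
  Real.tendsto_tsum_powerSeries_nhdsWithin_lt hs.hasSum.tendsto_sum_nat

/-- The difference quotient `(1 - q(g)) / (1 - g)` of a probability generating function `q`, as a
power series in `g`. -/
lemma hasSum_geom_sum {a : ℕ → ℝ} (ha : ∀ n, 0 ≤ a n) (h1 : HasSum a 1) {g : ℝ} (hg : 0 ≤ g)
    (hg1 : g < 1) :
    HasSum (fun n => a n * ∑ k ∈ Finset.range n, g ^ k) ((1 - genFun a g) / (1 - g)) := by
  have hs := summable_mul_pow ha h1.summable (z := g) (by rw [abs_of_nonneg hg]; exact hg1.le)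
  refine ((h1.sub hs.hasSum).div_const (1 - g)).congr_fun fun n => ?_
  have : (1 - g) ≠ 0 := by linarith
  rw [eq_div_iff this, mul_assoc, geom_sum_mul_neg]
  ring

/-- For `0 ≤ z < 1` the map `w ↦ z q(w)` contracts distances to its fixed point `g`, since
`|q(w) - q(g)| ≤ |w - g| (1 - q(g)) / (1 - g)` for `|w| ≤ 1`; hence `g` is its only fixed point
in `[-1, 1]`. -/
lemma eq_of_fixedPoint {a : ℕ → ℝ} (ha : ∀ n, 0 ≤ a n) (h1 : HasSum a 1) {z w g : ℝ}
    (hz : 0 ≤ z) (hz1 : z < 1) (hw : |w| ≤ 1) (hg0 : 0 ≤ g) (hg1 : g < 1)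
    (hgq : g = z * genFun a g) (hwq : w = z * genFun a w) : w = g := by
  have hsg := summable_mul_pow ha h1.summable (z := g) (by rw [abs_of_nonneg hg0]; exact hg1.le)
  have hsw := summable_mul_pow ha h1.summable hw
  have hq := hasSum_geom_sum ha h1 hg0 hg1
  have key : |genFun a w - genFun a g| ≤ |w - g| * ((1 - genFun a g) / (1 - g)) := by
    rw [genFun, genFun, ← hsw.tsum_sub hsg, ← Real.norm_eq_abs]
    refine tsum_of_norm_bounded (hq.mul_left |w - g|) fun n => ?_
    rw [← mul_sub, Real.norm_eq_abs, abs_mul, abs_of_nonneg (ha n), mul_left_comm]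
    exact mul_le_mul_of_nonneg_left (abs_pow_sub_pow_le_geom_sum hw hg0 n) (ha n)
  have h2 : |w - g| = z * |genFun a w - genFun a g| := by
    have : w - g = z * (genFun a w - genFun a g) := by rw [mul_sub, ← hwq, ← hgq]
    rw [this, abs_mul, abs_of_nonneg hz]
  have h3 : |w - g| ≤ |w - g| * ((z - g) / (1 - g)) := by
    calc |w - g| = z * |genFun a w - genFun a g| := h2
      _ ≤ z * (|w - g| * ((1 - genFun a g) / (1 - g))) := mul_le_mul_of_nonneg_left key hz
      _ = |w - g| * ((z - z * genFun a g) / (1 - g)) := by ring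
      _ = _ := by rw [← hgq]
  have h4 : (z - g) / (1 - g) < 1 := by
    rw [div_lt_one (by linarith)]; linarith
  have h5 : |w - g| = 0 := by
    by_contra h
    have : 0 < |w - g| := lt_of_le_of_ne (abs_nonneg _) (Ne.symm h)
    nlinarith
  exact sub_eq_zero.1 (abs_eq_zero.1 h5)

/-- A continuous solution of `h(z) = z q(h(z))` that starts at zero can never leave `[-1, 1]`,
because `|h(z)| = 1` would force `1 = z |q(h(z))| ≤ z`. -/
lemma abs_le_one_of_fixedPoint {a : ℕ → ℝ} (ha : ∀ n, 0 ≤ a n) (h1 : HasSum a 1) {h : ℝ → ℝ}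
    (hc : ContinuousOn h (Ico 0 1)) (h0 : h 0 = 0)
    (hfix : ∀ z ∈ Ico (0 : ℝ) 1, h z = z * genFun a (h z)) {z : ℝ} (hz : z ∈ Ico (0 : ℝ) 1) :
    |h z| ≤ 1 := by
  by_contra! hgt
  have hsub : Icc 0 z ⊆ Ico (0 : ℝ) 1 := fun x hx => ⟨hx.1, hx.2.trans_lt hz.2⟩
  obtain ⟨x, hx, hx1⟩ := intermediate_value_Icc hz.1 (hc.mono hsub).abs
    (show (1 : ℝ) ∈ Icc |h 0| |h z| from ⟨by simp [h0], hgt.le⟩)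
  have hx' := hsub hx
  have hle := abs_genFun_le ha h1.summable hx1.le
  rw [h1.tsum_eq] at hle
  have : |h x| = x * |genFun a (h x)| := by
    conv_lhs => rw [hfix x hx', abs_mul, abs_of_nonneg hx'.1]
  nlinarith [hx'.1, hx'.2]

/-- The mean of a law that is not concentrated at one exceeds one if the generating function has a
fixed point below one. -/
lemma one_lt_mean_of_fixedPoint {a : ℕ → ℝ} (ha : ∀ n, 0 ≤ a n) (h1 : HasSum a 1)
    (ha1 : a 1 ≠ 1) {s : ℝ} (hs0 : 0 ≤ s) (hs1 : s < 1) (hs : s = genFun a s) {m : ℝ}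
    (hm : HasSum (fun n => n * a n) m) : 1 < m := by
  have hq := hasSum_geom_sum ha h1 hs0 hs1
  rw [← hs, div_self (by linarith)] at hq
  have hsum (n : ℕ) : ∑ k ∈ Finset.range n, s ^ k ≤ n := by
    simpa using Finset.sum_le_card_nsmul (Finset.range n) (fun k => s ^ k) 1
      fun k _ => pow_le_one₀ hs0 hs1.le
  have hle (n : ℕ) : a n * ∑ k ∈ Finset.range n, s ^ k ≤ n * a n := by
    rw [mul_comm (n : ℝ)]
    exact mul_le_mul_of_nonneg_left (hsum n) (ha n)
  -- If no offspring number above one had positive weight, `hq` would read `a 1 = 1`.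
  obtain ⟨n, hn2, hn⟩ : ∃ n, 2 ≤ n ∧ a n ≠ 0 := by
    by_contra! h
    refine ha1 (HasSum.unique (hasSum_single 1 fun n hn => ?_ : HasSum _ _) hq ▸ by simp)
    rcases n with _ | _ | n
    · simp
    · exact absurd rfl hn
    · simp [h (n + 2) (by omega)]
  refine hasSum_lt hle (i := n) ?_ hq hm
  rw [mul_comm (n : ℝ)]
  refine mul_lt_mul_of_pos_left ?_ (lt_of_le_of_ne (ha n) (Ne.symm hn))
  have := Finset.sum_lt_sum (s := Finset.range n) (f := fun k => s ^ k) (g := fun _ => (1 : ℝ))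
    (fun k _ => pow_le_one₀ hs0 hs1.le) ⟨1, Finset.mem_range.2 hn2, by simpa using hs1⟩
  simpa using this

/-- If solutions `g < 1` of `g ≤ q(g)` accumulate at one, then the partial sums of the mean, being
limits of partial sums of `(1 - q(g)) / (1 - g) ≤ 1`, are at most one. -/
lemma sum_mean_le_one {a : ℕ → ℝ} (ha : ∀ n, 0 ≤ a n) (h1 : HasSum a 1) {l : Filter ℝ} [l.NeBot]
    {g : ℝ → ℝ} (hg0 : ∀ᶠ z in l, 0 ≤ g z) (hg1 : ∀ᶠ z in l, g z < 1)
    (hgq : ∀ᶠ z in l, g z ≤ genFun a (g z)) (hlim : Tendsto g l (𝓝 1)) (F : Finset ℕ) :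
    ∑ n ∈ F, n * a n ≤ 1 := by
  have hcont : Continuous fun x : ℝ => ∑ n ∈ F, a n * ∑ k ∈ Finset.range n, x ^ k := by fun_prop
  have ht := (hcont.tendsto 1).comp hlim
  have : ∑ n ∈ F, n * a n = ∑ n ∈ F, a n * ∑ k ∈ Finset.range n, (1 : ℝ) ^ k := by
    simp [mul_comm]
  rw [this]
  refine le_of_tendsto ht ?_
  filter_upwards [hg0, hg1, hgq] with z hz0 hz1 hzq
  refine (sum_le_hasSum F (fun n _ => mul_nonneg (ha n)
    (Finset.sum_nonneg fun k _ => pow_nonneg hz0 k)) (hasSum_geom_sum ha h1 hz0 hz1)).trans ?_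
  rw [div_le_one (by linarith)]
  linarith

/-! ### The law of the total progeny -/

/-- Disjoint subfamilies of an independent family, namely the fibers of a map of the index set,
are independent. -/
lemma iIndepFun_fiber {ι κ β Ω : Type*} [MeasurableSpace Ω] [MeasurableSpace β] {P : Measure Ω}
    {X : ι → Ω → β} (hX : ∀ i, Measurable (X i)) (h : iIndepFun X P) (b : ι → κ) :
    iIndepFun (fun k ω (i : {i // b i = k}) => X i ω) P := by
  have := h.isProbabilityMeasure
  have hp (i : ι) : IsProbabilityMeasure (P.map (X i)) :=
    Measure.isProbabilityMeasure_map (hX i).aemeasurable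
  rw [iIndepFun_iff_map_fun_eq_infinitePi_map (by fun_prop)]
  have hσ : iIndepFun (fun p : (k : κ) × {i // b i = k} => X p.2.1) P :=
    h.precomp (Equiv.sigmaFiberEquiv b).injective
  have h1 := hσ.map_fun_eq_infinitePi_map (fun p => hX _)
  have h2 := Measure.infinitePi_map_piCurry (X := fun k (_ : {i // b i = k}) => β)
    (fun k (i : {i // b i = k}) => P.map (X i))
  rw [← h1, Measure.map_map (by fun_prop) (by fun_prop)] at h2
  refine Eq.trans ?_ (h2.trans ?_)
  · rfl
  · congr 1 with k : 1
    exact ((h.precomp Subtype.val_injective).map_fun_eq_infinitePi_map fun i => hX _).symm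

/-- The power `zⁿ` with an exponent `n ≤ ∞`, where `z^∞ = 0` for all `z`. With this convention
`x ↦ z^x` turns sums into products even for `|z| = 1`. -/
noncomputable def enatPow (z : ℝ) (x : ℕ∞) : ℝ := if x = ⊤ then 0 else z ^ x.toNat

@[simp] lemma enatPow_coe (z : ℝ) (n : ℕ) : enatPow z n = z ^ n := by simp [enatPow]

@[simp] lemma enatPow_top (z : ℝ) : enatPow z ⊤ = 0 := by simp [enatPow]

lemma enatPow_add (z : ℝ) (x y : ℕ∞) : enatPow z (x + y) = enatPow z x * enatPow z y := by
  induction x with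
  | top => simp
  | coe m =>
    induction y with
    | top => simp
    | coe n => rw [← Nat.cast_add]; simp only [enatPow_coe, pow_add]

lemma enatPow_sum (z : ℝ) {ι : Type*} (s : Finset ι) (x : ι → ℕ∞) :
    enatPow z (∑ i ∈ s, x i) = ∏ i ∈ s, enatPow z (x i) := by
  classical
  induction s using Finset.induction_on with
  | empty => simpa using enatPow_coe z 0
  | insert i s hi ih => rw [Finset.sum_insert hi, Finset.prod_insert hi, enatPow_add, ih]

lemma abs_enatPow_le {z : ℝ} (hz : |z| ≤ 1) (x : ℕ∞) : |enatPow z x| ≤ 1 := by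
  induction x with
  | top => simp
  | coe n => rw [enatPow_coe, abs_pow]; exact pow_le_one₀ (abs_nonneg _) hz

lemma measurable_enatPow_progeny (z : ℝ) : Measurable fun x => enatPow z (progeny x) :=
  (Measurable.of_discrete (f := enatPow z)).comp measurable_progeny

lemma enatPow_progeny (z : ℝ) (x : List ℕ → ℕ) :
    enatPow z (progeny x) =
      z * ∏ i : Fin (x []), enatPow z (progeny fun u => x (u ++ [(i : ℕ)])) := by
  rw [progeny_eq, enatPow_add, enatPow_sum]
  congr 1
  simpa using enatPow_coe z 1

/-- The joint law of the offspring numbers of all potential nodes. -/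
noncomputable abbrev offspringLaw (f : PMF ℕ) : Measure (List ℕ → ℕ) :=
  Measure.infinitePi fun _ : List ℕ => f.toMeasure

/-- The probability that the total progeny equals `n`. -/
noncomputable def progenyProb (f : PMF ℕ) (n : ℕ) : ℝ :=
  (offspringLaw f).real {x | progeny x = n}

variable {f : PMF ℕ}

lemma measurableSet_progeny_eq (n : ℕ∞) : MeasurableSet {x | progeny x = n} :=
  measurable_progeny (measurableSet_singleton n)

lemma measurableSet_root_eq (j : ℕ) : MeasurableSet {x : List ℕ → ℕ | x [] = j} :=
  measurable_pi_apply (X := fun _ : List ℕ => ℕ) [] (measurableSet_singleton j)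

lemma integrable_enatPow_progeny {z : ℝ} (hz : |z| ≤ 1) :
    Integrable (fun x => enatPow z (progeny x)) (offspringLaw f) :=
  .of_bound (measurable_enatPow_progeny z).aestronglyMeasurable 1
    (ae_of_all _ fun _ => abs_enatPow_le hz _)

lemma hasSum_genFun_progenyProb {z : ℝ} (hz : |z| ≤ 1) :
    HasSum (fun n => progenyProb f n * z ^ n)
      (∫ x, enatPow z (progeny x) ∂offspringLaw f) := by
  have hd : Pairwise (Function.onFun Disjoint fun n : ℕ => {x | progeny x = n}) :=
    fun m n hmn => disjoint_left.2 fun x hm hn => hmn (by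
      exact_mod_cast (hm : progeny x = m).symm.trans (hn : progeny x = n))
  have h := hasSum_integral_iUnion (fun n : ℕ => measurableSet_progeny_eq n) hd
    (integrable_enatPow_progeny (f := f) hz).integrableOn
  -- The realizations outside the union have `progeny x = ⊤` and do not contribute.
  rw [setIntegral_eq_integral_of_forall_compl_eq_zero] at h
  · refine h.congr_fun fun n => ?_
    rw [setIntegral_congr_fun (measurableSet_progeny_eq n)
      (fun x (hx : progeny x = n) => by rw [hx, enatPow_coe] : EqOn _ (fun _ => z ^ n) _),
      setIntegral_const, smul_eq_mul, progenyProb]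
  · intro x hx
    have : progeny x = ⊤ := by
      by_contra hne
      exact hx (mem_iUnion.2 ⟨(progeny x).toNat, (ENat.natCast_toNat hne).symm⟩)
    rw [this, enatPow_top]

lemma integral_enatPow_progeny {z : ℝ} (hz : |z| ≤ 1) :
    ∫ x, enatPow z (progeny x) ∂offspringLaw f = genFun (progenyProb f) z :=
  (hasSum_genFun_progenyProb hz).tsum_eq.symm

lemma progenyProb_nonneg (n : ℕ) : 0 ≤ progenyProb f n := measureReal_nonneg

lemma summable_progenyProb : Summable (progenyProb f) := by
  simpa using (hasSum_genFun_progenyProb (f := f) (z := 1) (by simp)).summable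

lemma tsum_progenyProb :
    ∑' n, progenyProb f n = 1 - (offspringLaw f).real {x | progeny x = ⊤} := by
  have h := (hasSum_genFun_progenyProb (f := f) (z := 1) (by simp)).tsum_eq
  have h2 : (fun x => enatPow 1 (progeny x)) = indicator {x | progeny x = ⊤}ᶜ 1 := by
    ext x
    by_cases hx : progeny x = ⊤ <;> simp [enatPow, hx]
  simp only [one_pow, mul_one] at h
  rw [h, h2, integral_indicator_one (measurableSet_progeny_eq ⊤).compl,
    probReal_compl_eq_one_sub (measurableSet_progeny_eq ⊤)]

lemma progenyProb_zero : progenyProb f 0 = 0 := by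
  simp [progenyProb, progeny_ne_zero]

/-- The subtree of each child of the root has the same law as the whole tree. -/
lemma integral_enatPow_subtree (z : ℝ) (i : ℕ) :
    ∫ x, enatPow z (progeny fun u => x (u ++ [i])) ∂offspringLaw f =
      ∫ x, enatPow z (progeny x) ∂offspringLaw f := by
  have hinj : Function.Injective fun u : List ℕ => u ++ [i] :=
    fun u v h => (List.append_singleton_inj.1 h).1
  have h := Measure.map_infinitePi_infinitePi_of_inj (P := fun _ : List ℕ => f.toMeasure) hinj
  have hshift : Measurable fun (x : List ℕ → ℕ) (u : List ℕ) => x (u ++ [i]) :=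
    measurable_pi_lambda _ fun u => measurable_pi_apply (u ++ [i])
  conv_rhs => rw [offspringLaw, ← h]
  rw [integral_map hshift.aemeasurable
    (measurable_enatPow_progeny z).aestronglyMeasurable]

/-- Conditioning on the number `j` of children of the root: the root's offspring number and the
subtrees of its children are independent, since they depend on nodes with different last letters
(the last letter of an address says through which child of the root a node descends). -/
lemma setIntegral_prod_subtree (z : ℝ) (j : ℕ) :
    ∫ x in {x | x [] = j}, ∏ i : Fin j, enatPow z (progeny fun u => x (u ++ [(i : ℕ)]))
      ∂offspringLaw f = (f j).toReal * (∫ x, enatPow z (progeny x) ∂offspringLaw f) ^ j := by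
  have hind : iIndepFun (fun (u : List ℕ) (x : List ℕ → ℕ) => x u) (offspringLaw f) :=
    iIndepFun_infinitePi (X := fun _ n => n) fun _ => measurable_id
  let ψ (o : Option ℕ) : ({u : List ℕ // u.getLast? = o} → ℕ) → ℝ :=
    match o with
    | none => fun y => indicator {j} 1 (y ⟨[], rfl⟩)
    | some i => fun y => enatPow z (progeny fun u => y ⟨u ++ [i], by simp⟩)
  have hψ (o : Option ℕ) : Measurable (ψ o) := by
    rcases o with _ | i
    · exact (Measurable.of_discrete (f := indicator {j} (1 : ℕ → ℝ))).comp (measurable_pi_apply _)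
    · exact (measurable_enatPow_progeny z).comp
        (measurable_pi_lambda _ fun u => measurable_pi_apply _)
  have hY := ((iIndepFun_fiber measurable_pi_apply hind List.getLast?).comp ψ hψ).precomp
    (g := Option.map (Fin.val : Fin j → ℕ)) (Option.map_injective Fin.val_injective)
  have hprod := hY.integral_fun_prod_eq_prod_integral fun o =>
    ((hψ _).comp (measurable_pi_lambda _ fun u => measurable_pi_apply _)).aestronglyMeasurable
  have hmeas := measurableSet_root_eq j
  have hroot : ∫ x, indicator {j} (1 : ℕ → ℝ) (x []) ∂offspringLaw f = (f j).toReal := by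
    have : (fun x : List ℕ → ℕ => indicator {j} (1 : ℕ → ℝ) (x [])) =
        indicator {x | x [] = j} 1 := rfl
    rw [this, integral_indicator_one hmeas, measureReal_def]
    congr 1
    rw [← f.toMeasure_apply_singleton j (measurableSet_singleton j),
      ← Measure.infinitePi_map_eval (fun _ : List ℕ => f.toMeasure) [],
      Measure.map_apply (f := fun x : List ℕ → ℕ => x []) (by fun_prop)
        (measurableSet_singleton j)]
    rfl
  simp only [Fintype.prod_option] at hprod
  rw [← integral_indicator hmeas]
  calc _ = ∫ x, indicator {j} (1 : ℕ → ℝ) (x []) *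
        ∏ i : Fin j, enatPow z (progeny fun u => x (u ++ [(i : ℕ)])) ∂offspringLaw f := by
        congr 1 with x
        by_cases hx : x [] = j <;> simp [hx]
    _ = (∫ x, indicator {j} (1 : ℕ → ℝ) (x []) ∂offspringLaw f) *
        ∏ i : Fin j, ∫ x, enatPow z (progeny fun u => x (u ++ [(i : ℕ)])) ∂offspringLaw f := hprod
    _ = _ := by
        rw [hroot]
        simp [integral_enatPow_subtree]

theorem genFun_progenyProb {z : ℝ} (hz : |z| ≤ 1) :
    genFun (progenyProb f) z = z * offspringGF f (genFun (progenyProb f) z) := by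
  have hd : Pairwise (Function.onFun Disjoint fun j : ℕ => {x : List ℕ → ℕ | x [] = j}) :=
    fun m n hmn => disjoint_left.2 fun x hm hn =>
      hmn ((hm : x [] = m).symm.trans (hn : x [] = n))
  have h := hasSum_integral_iUnion measurableSet_root_eq hd
    (integrable_enatPow_progeny (f := f) hz).integrableOn
  have huniv : ⋃ j, {x : List ℕ → ℕ | x [] = j} = univ := by ext; simp
  rw [huniv, setIntegral_univ, integral_enatPow_progeny hz] at h
  refine h.tsum_eq.symm.trans ?_
  rw [offspringGF, genFun.eq_def fun n => (f n).toReal, ← tsum_mul_left]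
  refine tsum_congr fun j => ?_
  rw [← integral_enatPow_progeny hz, ← setIntegral_prod_subtree, ← integral_const_mul]
  refine setIntegral_congr_fun (measurableSet_root_eq j) fun x (hx : x [] = j) => ?_
  subst hx
  exact enatPow_progeny z x

/-! ### Extinction and the mean offspring number -/

lemma hasSum_toReal_pmf (f : PMF ℕ) : HasSum (fun n => (f n).toReal) 1 := by
  have h := ENNReal.hasSum_toReal (f := fun n => f n) (by simp [f.tsum_coe])
  rwa [← ENNReal.tsum_toReal_eq f.apply_ne_top, f.tsum_coe, ENNReal.toReal_one] at h

lemma genFun_progenyProb_nonneg (f : PMF ℕ) {z : ℝ} (hz : 0 ≤ z) :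
    0 ≤ genFun (progenyProb f) z :=
  genFun_nonneg progenyProb_nonneg hz

lemma tsum_progenyProb_le_one (f : PMF ℕ) : ∑' n, progenyProb f n ≤ 1 := by
  rw [tsum_progenyProb]
  linarith [measureReal_nonneg (μ := offspringLaw f) (s := {x | progeny x = ⊤})]

lemma genFun_progenyProb_lt_one (f : PMF ℕ) {z : ℝ} (hz : z ∈ Ico (0 : ℝ) 1) :
    genFun (progenyProb f) z < 1 := by
  have hz1 : |z| ≤ 1 := by rw [abs_of_nonneg hz.1]; exact hz.2.le
  have h1 := (le_abs_self _).trans ((abs_genFun_le progenyProb_nonneg summable_progenyProb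
    hz1).trans (tsum_progenyProb_le_one f))
  have h0 := genFun_progenyProb_nonneg f hz.1
  have hq := (le_abs_self _).trans (abs_genFun_le (a := fun n => (f n).toReal)
    (fun n => ENNReal.toReal_nonneg) (hasSum_toReal_pmf f).summable
    (z := genFun (progenyProb f) z) (by rwa [abs_of_nonneg h0]))
  rw [(hasSum_toReal_pmf f).tsum_eq] at hq
  rw [genFun_progenyProb hz1]
  exact (mul_le_of_le_one_right hz.1 hq).trans_lt hz.2

/-- The tree is almost surely finite exactly in the critical and subcritical cases. -/
lemma tsum_progenyProb_eq_one_iff {f : PMF ℕ} (hf : f 1 ≠ 1) :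
    ∑' n, progenyProb f n = 1 ↔ offspringMean f ≤ 1 := by
  have ha : ∀ n, 0 ≤ (f n).toReal := fun n => ENNReal.toReal_nonneg
  have h1 := hasSum_toReal_pmf f
  have hs : genFun (progenyProb f) 1 = ∑' n, progenyProb f n := by simp [genFun]
  constructor
  · intro h
    have hlim := tendsto_genFun (summable_progenyProb (f := f))
    rw [h] at hlim
    have hev : ∀ᶠ z : ℝ in 𝓝[<] 1, z ∈ Ico (0 : ℝ) 1 := Ico_mem_nhdsLT one_pos
    have hF := sum_mean_le_one ha h1 (hev.mono fun z hz => genFun_progenyProb_nonneg f hz.1)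
      (hev.mono fun z hz => genFun_progenyProb_lt_one f hz) (hev.mono fun z hz => ?_) hlim
    · rw [offspringMean, ENNReal.tsum_eq_iSup_sum]
      refine iSup_le fun F => ?_
      have : ∑ n ∈ F, (n : ENNReal) * f n = ENNReal.ofReal (∑ n ∈ F, n * (f n).toReal) := by
        rw [ENNReal.ofReal_sum_of_nonneg fun n _ => mul_nonneg n.cast_nonneg (ha n)]
        refine Finset.sum_congr rfl fun n _ => ?_
        rw [ENNReal.ofReal_mul n.cast_nonneg, ENNReal.ofReal_natCast,
          ENNReal.ofReal_toReal (f.apply_ne_top n)]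
      rw [this]
      exact ENNReal.ofReal_le_one.2 (hF F)
    · have hz1 : |z| ≤ 1 := by rw [abs_of_nonneg hz.1]; exact hz.2.le
      have hG := genFun_nonneg ha (genFun_progenyProb_nonneg f hz.1)
      conv_lhs => rw [genFun_progenyProb hz1]
      exact mul_le_of_le_one_left hG hz.2.le
  · intro hm
    by_contra hne
    have hlt := lt_of_le_of_ne (tsum_progenyProb_le_one f) hne
    have hfix := genFun_progenyProb (f := f) (z := 1) (by simp)
    rw [hs, one_mul] at hfix
    have hmean := ENNReal.hasSum_toReal (f := fun n : ℕ => (n : ENNReal) * f n)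
      (hm.trans_lt ENNReal.one_lt_top).ne
    simp only [ENNReal.toReal_mul, ENNReal.toReal_natCast] at hmean
    have hf' : (f 1).toReal ≠ 1 := fun h => hf ((ENNReal.toReal_eq_one_iff _).1 h)
    have hgt := one_lt_mean_of_fixedPoint ha h1 hf' (tsum_nonneg progenyProb_nonneg) hlt hfix hmean
    have hle : (offspringMean f).toReal ≤ 1 :=
      ENNReal.toReal_le_of_le_ofReal zero_le_one (by simpa using hm)
    rw [offspringMean, ENNReal.tsum_toReal_eq fun n =>
      ENNReal.mul_ne_top (ENNReal.natCast_ne_top n) (f.apply_ne_top n)] at hle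
    simp only [ENNReal.toReal_mul, ENNReal.toReal_natCast] at hle
    exact absurd hgt (not_lt.2 hle)

end EvolvingTree

theorem mainTheorem2 {Ω : Type*} [MeasurableSpace Ω] (P : Measure Ω) [IsProbabilityMeasure P]
    (f : PMF ℕ) (hf : f 1 ≠ 1) (Q : ℝ) (hQ : 0 < Q)
    (ν : List ℕ → Ω → ℕ) (τ : List ℕ → Ω → ℝ)
    (hν : ∀ u, Measurable (ν u)) (hτ : ∀ u, Measurable (τ u))
    (hνlaw : ∀ u, P.map (ν u) = f.toMeasure) (hτlaw : ∀ u, P.map (τ u) = expMeasure Q)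
    (hind : iIndepFun (fun u ω => (ν u ω, τ u ω)) P) (hντ : ∀ u, IndepFun (ν u) (τ u) P) :
    ∃ p : ℕ → ℝ,
      -- the limit distribution of the tree size
      (∀ n : ℕ, Tendsto
        (fun t : ℝ => P.real {ω | EvolvingTree.treeSize (fun u => ν u ω) (fun u => τ u ω) t = n})
        atTop (𝓝 (p n))) ∧
      p 0 = 0 ∧ (∀ n, 0 ≤ p n) ∧ Summable p ∧
      -- its generating function solves the fixed point equation and vanishes at zero
      (∀ z ∈ Icc (-1 : ℝ) 1, EvolvingTree.genFun p z =
        z * EvolvingTree.offspringGF f (EvolvingTree.genFun p z)) ∧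
      EvolvingTree.genFun p 0 = 0 ∧
      -- it is the only continuous solution on `[0, 1)` that vanishes at zero
      (∀ h : ℝ → ℝ, ContinuousOn h (Ico 0 1) → h 0 = 0 →
        (∀ z ∈ Ico (0 : ℝ) 1, Summable (fun n => (f n).toReal * h z ^ n) ∧
          h z = z * EvolvingTree.offspringGF f (h z)) →
        EqOn h (EvolvingTree.genFun p) (Ico 0 1)) ∧
      -- the behaviour at one
      Tendsto (EvolvingTree.genFun p) (𝓝[<] 1) (𝓝 (∑' n, p n)) ∧
      (EvolvingTree.offspringMean f ≤ 1 →
        Tendsto (EvolvingTree.genFun p) (𝓝[<] 1) (𝓝 1)) ∧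
      (1 < EvolvingTree.offspringMean f →
        ∃ L < 1, Tendsto (EvolvingTree.genFun p) (𝓝[<] 1) (𝓝 L)) ∧
      -- the probability of an infinite stationary tree
      P.real {ω | Tendsto (fun t : ℝ =>
          EvolvingTree.treeSize (fun u => ν u ω) (fun u => τ u ω) t) atTop (𝓝 ⊤)} =
        1 - ∑' n, p n ∧
      (1 - ∑' n, p n = 0 ↔ EvolvingTree.offspringMean f ≤ 1) := by
  have hνm : Measurable fun ω u => ν u ω := measurable_pi_lambda _ hν
  have hlaw : P.map (fun ω u => ν u ω) = EvolvingTree.offspringLaw f := by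
    have h : iIndepFun ν P := hind.comp (fun _ => Prod.fst) fun _ => measurable_fst
    rw [h.map_fun_eq_infinitePi_map hν]
    simp only [hνlaw]
  have hprob (n : ℕ∞) : P.real {ω | EvolvingTree.progeny (fun u => ν u ω) = n} =
      (EvolvingTree.offspringLaw f).real {x | EvolvingTree.progeny x = n} := by
    rw [← hlaw, map_measureReal_apply hνm (EvolvingTree.measurableSet_progeny_eq n)]
    rfl
  have hlim := EvolvingTree.tendsto_genFun (EvolvingTree.summable_progenyProb (f := f))
  have hiff := EvolvingTree.tsum_progenyProb_eq_one_iff hf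
  refine ⟨EvolvingTree.progenyProb f, fun n => ?_, EvolvingTree.progenyProb_zero,
    EvolvingTree.progenyProb_nonneg, EvolvingTree.summable_progenyProb,
    fun z hz => EvolvingTree.genFun_progenyProb (abs_le.2 hz), ?_, fun h hc h0 hfix z hz => ?_,
    hlim, fun hq => ?_, fun hq => ?_, ?_, ?_⟩
  · rw [EvolvingTree.progenyProb, ← hprob]
    refine (ENNReal.tendsto_toReal (measure_ne_top _ _)).comp
      (tendsto_measure_of_ae_tendsto_indicator_of_isFiniteMeasure atTop
        (hνm (EvolvingTree.measurableSet_progeny_eq n))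
        (fun t => EvolvingTree.measurable_treeSize hν hτ t (measurableSet_singleton _))
        (ae_of_all _ fun ω => EvolvingTree.eventually_treeSize_eq_iff _ _ n))
  · rw [EvolvingTree.genFun_zero, EvolvingTree.progenyProb_zero]
  · exact EvolvingTree.eq_of_fixedPoint (fun n => ENNReal.toReal_nonneg)
      (EvolvingTree.hasSum_toReal_pmf f) hz.1 hz.2
      (EvolvingTree.abs_le_one_of_fixedPoint (fun n => ENNReal.toReal_nonneg)
        (EvolvingTree.hasSum_toReal_pmf f) hc h0 (fun z hz => (hfix z hz).2) hz)
      (EvolvingTree.genFun_progenyProb_nonneg f hz.1)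
      (EvolvingTree.genFun_progenyProb_lt_one f hz)
      (EvolvingTree.genFun_progenyProb (by rw [abs_of_nonneg hz.1]; exact hz.2.le))
      (hfix z hz).2
  · rwa [hiff.2 hq] at hlim
  · exact ⟨_, lt_of_le_of_ne (EvolvingTree.tsum_progenyProb_le_one f)
      fun h => not_le.2 hq (hiff.1 h), hlim⟩
  · simp only [EvolvingTree.tendsto_treeSize_top_iff]
    rw [hprob, EvolvingTree.tsum_progenyProb, sub_sub_cancel]
  · rw [sub_eq_zero, eq_comm, hiff]
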